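/- **Setting.** A single item is sold to $m$ bidders. Bidder $i$ has a finite type set $T_i$; her type $t_i$ is drawn from a probability distribution $p_i$ on $T_i$, independently across bidders (the $p_i$ need not be identical). A *mechanism* $M$ assigns to each type profile $t\in\prod_i T_i$ probabilities $\phi_i(t)\ge 0$ with $\sum_i\phi_i(t)\le 1$, where $\phi_i(t)$ is the probability that bidder $i$ gets the item. Its *reduced form* is $M_i(A)=\mathbb E_{t_{-i}}[\phi_i(A;t_{-i})]$ for $A\in T_i$, the expectation being over the independent types of the other bidders. A vector $\pi=(\pi_i(A))_{i,\,A\in T_i}\in[0,1]^{\sum_i|T_i|}$ is a *feasible reduced form* if some mechanism $M$ satisfies $M_i(A)\ge\pi_i(A)$ for all $i,A$; $M$ *exactly implements* $\pi$ if $M_i(A)=\pi_i(A)$ for all $i,A$. A *hierarchical mechanism* is a function $H:\bigcup_i(T_i\times\{i\})\to\{1,\dots,\sum_i|T_i|\}\cup\{\mathrm{LOSE}\}$, where $\mathrm{LOSE}$ is larger than all numbers. On reports $(A_1,\dots,A_m)$ the item is thrown away if $H(A_i,i)=\mathrm{LOSE}$ for all $i$, and otherwise is awarded uniformly at random to a bidder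 in $\arg\min_i H(A_i,i)$. $H$ is *strict* if for all $i\ne j$, $A\in T_i$, $B\in T_j$, either $H(A,i)\ne H(B,j)$ or $H(A,i)=H(B,j)=\mathrm{LOSE}$. $H$ is *partially ordered with respect to $\pi$* if $\pi_i(A)\ge\pi_i(A')$ implies $H(A,i)\le H(A',i)$, for all $i$ and $A,A'\in T_i$. Given total orders $>^i$ on the sets $T_i$, $\pi$ *respects* $>^1,\dots,>^m$ if $A>^iA'$ implies $\pi_i(A)\ge\pi_i(A')$, and $H$ is *partially ordered with respect to $>^1,\dots,>^m$* if $A>^iA'$ implies $H(A,i)\le H(A',i)$. **Theorem.** (1) Every feasible reduced form $\pi$ is exactly implemented by a probability distribution over at most $\sum_i|T_i|+1$ strict hierarchical mechanisms that are partially ordered with respect to $\pi$. (2) Suppose moreover that $p_i(A)>0$ for all $i$ and all $A\in T_i$, and let $>^i$ be a total order on $T_i$ for each $i$. Then the set of feasible reduced forms that respect $>^1,\dots,>^m$ is a polytope of dimension $\sum_i|T_i|$, and its vertices are exactly the reduced forms of the strict hierarchical mechanisms that are partially ordered with respect to $>^1,\dots,>^m$. -/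

import Mathlib

/-! Single-item auctions with `m` independent bidders.  Bidder `i` has the finite type set `T i`, and
her type has the probability mass function `p i`; type profiles follow the product distribution. -/

namespace SingleItem

/-- A (randomized, direct) single-item mechanism: on the reported type profile `t`, bidder `i`
receives the item with probability `alloc t i`, and the item is never over-allocated. -/
structure Mechanism {m : ℕ} (T : Fin m → Type*) where
  alloc : (∀ i, T i) → Fin m → ℝ
  nonneg : ∀ t i, 0 ≤ alloc t i
  sum_le_one : ∀ t, ∑ i, alloc t i ≤ 1

/-- The reduced form of a mechanism: `M.reducedForm p i A` is the probability that bidder `i`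
receives the item when she reports `A` and the others report their true, independent types.
(The report of bidder `i` in the profile `t` is overwritten by `A`, so that the average over all
profiles `t` is the average over the types of the other bidders.) -/
noncomputable def Mechanism.reducedForm {m : ℕ} {T : Fin m → Type*} [∀ i, Fintype (T i)]
    (p : ∀ i, T i → ℝ) (M : Mechanism T) : ∀ i, T i → ℝ :=
  fun i A => ∑ t : (∀ j, T j), (∏ j, p j (t j)) * M.alloc (Function.update t i A) i

/-- `M` implements `π`: every type gets the item with at least the prescribed probability. -/
def Mechanism.Implements {m : ℕ} {T : Fin m → Type*} [∀ i, Fintype (T i)]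
    (M : Mechanism T) (p π : ∀ i, T i → ℝ) : Prop :=
  ∀ i A, π i A ≤ M.reducedForm p i A

/-- `M` exactly implements `π`. -/
def Mechanism.ExactlyImplements {m : ℕ} {T : Fin m → Type*} [∀ i, Fintype (T i)]
    (M : Mechanism T) (p π : ∀ i, T i → ℝ) : Prop :=
  ∀ i A, M.reducedForm p i A = π i A

/-- A reduced form, that is, a vector with entries in `[0, 1]`, is feasible if some mechanism
implements it. -/
def IsFeasible {m : ℕ} {T : Fin m → Type*} [∀ i, Fintype (T i)] (p π : ∀ i, T i → ℝ) : Prop :=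
  (∀ i A, π i A ∈ Set.Icc (0 : ℝ) 1) ∧ ∃ M : Mechanism T, M.Implements p π

/-- The mechanism that draws `k` from the finite set `s` with probability `q k`, and then
runs `M k`. -/
def Mechanism.mixture {m : ℕ} {T : Fin m → Type*} {κ : Type*} (s : Finset κ) (q : κ → ℝ)
    (hq : ∀ k ∈ s, 0 ≤ q k) (hq1 : ∑ k ∈ s, q k = 1) (M : κ → Mechanism T) : Mechanism T where
  alloc t i := ∑ k ∈ s, q k * (M k).alloc t i
  nonneg t i := Finset.sum_nonneg fun k hk => mul_nonneg (hq k hk) ((M k).nonneg t i)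
  sum_le_one t := by
    rw [Finset.sum_comm, ← hq1]
    refine Finset.sum_le_sum fun k hk => ?_
    rw [← Finset.mul_sum]
    exact mul_le_of_le_one_right (hq k hk) ((M k).sum_le_one t)

/-- A hierarchical mechanism: a map from the disjoint union of the type sets to
`∑ i, |T i|` levels together with an additional largest value `⊤`, which stands for LOSE. -/
abbrev HierarchicalMechanism {m : ℕ} (T : Fin m → Type*) [∀ i, Fintype (T i)] :=
  (Σ i, T i) → WithTop (Fin (∑ i, Fintype.card (T i)))

namespace HierarchicalMechanism

/-- The bidders whose reported types are on the smallest level that is present in the profile `t`;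
no bidder, if all of them are on the level LOSE. -/
def winners {m : ℕ} {T : Fin m → Type*} [∀ i, Fintype (T i)]
    (H : HierarchicalMechanism T) (t : ∀ i, T i) : Finset (Fin m) :=
  {i | H ⟨i, t i⟩ ≠ ⊤ ∧ ∀ j, H ⟨i, t i⟩ ≤ H ⟨j, t j⟩}

/-- The mechanism run by `H`: the item goes to a uniformly random bidder among the winners, and is
thrown away if there is none. -/
noncomputable def toMechanism {m : ℕ} {T : Fin m → Type*} [∀ i, Fintype (T i)]
    (H : HierarchicalMechanism T) : Mechanism T where
  alloc t i := if i ∈ H.winners t then 1 / ((H.winners t).card : ℝ) else 0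
  nonneg t i := by split_ifs <;> positivity
  sum_le_one t := by
    rw [Finset.sum_ite_mem, Finset.univ_inter, Finset.sum_const, nsmul_eq_mul, one_div]
    exact mul_inv_le_one

/-- Every level, except possibly LOSE, contains types of a single bidder only. -/
def IsStrict {m : ℕ} {T : Fin m → Type*} [∀ i, Fintype (T i)]
    (H : HierarchicalMechanism T) : Prop :=
  ∀ (i j : Fin m) (A : T i) (B : T j), i ≠ j →
    H ⟨i, A⟩ ≠ H ⟨j, B⟩ ∨ (H ⟨i, A⟩ = H ⟨j, B⟩ ∧ H ⟨j, B⟩ = ⊤)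

/-- `H` is partially ordered with respect to the reduced form `π`. -/
def IsPartiallyOrdered {m : ℕ} {T : Fin m → Type*} [∀ i, Fintype (T i)]
    (H : HierarchicalMechanism T) (π : ∀ i, T i → ℝ) : Prop :=
  ∀ (i : Fin m) (A A' : T i), π i A ≥ π i A' → H ⟨i, A⟩ ≤ H ⟨i, A'⟩

/-- `H` is partially ordered with respect to total orders of the type sets: larger types are on
smaller levels. -/
def IsPartiallyOrderedWrt {m : ℕ} {T : Fin m → Type*} [∀ i, Fintype (T i)]
    (H : HierarchicalMechanism T) (ord : ∀ i, LinearOrder (T i)) : Prop :=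
  ∀ (i : Fin m) (A A' : T i), (ord i).le A' A → H ⟨i, A⟩ ≤ H ⟨i, A'⟩

end HierarchicalMechanism

/-- `π` respects total orders of the type sets: larger types have larger values. -/
def Respects {m : ℕ} {T : Fin m → Type*} (π : ∀ i, T i → ℝ) (ord : ∀ i, LinearOrder (T i)) :
    Prop :=
  ∀ (i : Fin m) (A A' : T i), (ord i).le A' A → π i A' ≤ π i A

/-- The set of feasible reduced forms that respect the given total orders. -/
def feasibleRespecting {m : ℕ} {T : Fin m → Type*} [∀ i, Fintype (T i)]
    (p : ∀ i, T i → ℝ) (ord : ∀ i, LinearOrder (T i)) : Set (∀ i, T i → ℝ) :=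
  {π | IsFeasible p π ∧ Respects π ord}

end SingleItem

/-!
The reduced forms implemented by mechanisms form a convex set, and everything rests on maximizing a
linear functional `w` over those that are monotone in given rankings `ρ` of the type sets.

Suppose first that all types have positive probability. Let `v` be the projection of `w / p`, in the
inner product weighted by `p`, onto the closed convex cone of nonnegative monotone vectors. The
obtuse-angle inequality of the projection says two things. Every monotone `x ≥ 0` satisfies
`⟨w, x⟩ ≤ ⟨p v, x⟩`; and equality holds when `x` is an increasing function of `v` that vanishes
where `v` does, for then `v - ε x` stays in the cone for small `ε > 0`. The strict hierarchical
mechanism that ranks types by `v`, with ties broken by the bidder's index and types of value `0` on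
LOSE, maximizes the expected value `⟨p v, ·⟩` over all mechanisms, because it does so on each type
profile; its reduced form is an `x` as above, so it also maximizes `⟨w, ·⟩`
(`exists_hierarchical_sum_le_of_pos`). Here `v` plays the role of ironed virtual values. Types of
probability zero are reached by perturbing `p` (`exists_hierarchical_sum_le`).

By the separation theorem, a feasible reduced form that is monotone in `ρ` is a convex combination
of reduced forms of strict partially ordered hierarchical mechanisms (`IsFeasible.mem_convexHull`).
With `ρ = π` and Carathéodory's theorem this is the first part. With `ρ` the position in the given
orders it shows that the feasible reduced forms that respect the orders are the convex hull of
finitely many points, among which the extreme points must lie. All of these points are extreme: a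
strict hierarchical mechanism is the unique optimal mechanism for values that decrease strictly
with the level and are negative on LOSE (`IsStrict.reducedForm_mem_exposedPoints`). The dimension is
full, since indicators of upper sets of types are feasible and their differences give all coordinate
vectors.
-/

namespace SingleItem

/-! ### Weighted projections -/

section Projection

/-- Weighted projection onto a closed convex set `K` of vectors: with the weights `p > 0`, the point
of `K` nearest to `w / p` satisfies the obtuse-angle inequality below. -/
theorem exists_mem_forall_sum_sub_mul_sub_le_zero {ι : Type*} [Fintype ι] {K : Set (ι → ℝ)}
    (hne : K.Nonempty) (hclosed : IsClosed K) (hconv : Convex ℝ K)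
    {p : ι → ℝ} (hp : ∀ a, 0 < p a) (w : ι → ℝ) :
    ∃ v ∈ K, ∀ x ∈ K, ∑ a, (w a - p a * v a) * (x a - v a) ≤ 0 := by
  -- Rescaling the coordinates by `√p` turns the weighted inner product into the Euclidean one.
  let r : ι → ℝ := fun a => Real.sqrt (p a)
  have hr : ∀ a, 0 < r a := fun a => Real.sqrt_pos.2 (hp a)
  have hrr : ∀ a, r a * r a = p a := fun a => Real.mul_self_sqrt (hp a).le
  let L : EuclideanSpace ℝ ι →ₗ[ℝ] (ι → ℝ) :=
    { toFun := fun y a => y a / r a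
      map_add' := fun y z => by ext a; simp [add_div]
      map_smul' := fun c y => by ext a; simp [mul_div_assoc] }
  have hL : Continuous L := L.continuous_of_finiteDimensional
  obtain ⟨x₀, hx₀⟩ := hne
  have hLx : ∀ x : ι → ℝ, L (WithLp.toLp 2 fun a => r a * x a) = x := fun x => by
    ext a
    exact mul_div_cancel_left₀ _ (hr a).ne'
  have hcK : Convex ℝ (L ⁻¹' K) := hconv.linear_preimage L
  obtain ⟨y, hyK, hy⟩ := exists_norm_eq_iInf_of_complete_convex
    (K := L ⁻¹' K) ⟨_, by rw [Set.mem_preimage, hLx]; exact hx₀⟩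
    (hclosed.preimage hL).isComplete hcK (WithLp.toLp 2 fun a => w a / r a)
  rw [norm_eq_iInf_iff_real_inner_le_zero hcK hyK] at hy
  refine ⟨L y, hyK, fun x hx => ?_⟩
  have h := hy (WithLp.toLp 2 fun a => r a * x a) (by rw [Set.mem_preimage, hLx]; exact hx)
  rw [PiLp.inner_apply] at h
  refine le_of_eq_of_le (Finset.sum_congr rfl fun a _ => ?_) h
  have hra := (hr a).ne'
  change (w a - p a * (y a / r a)) * (x a - y a / r a) = (r a * x a - y a) * (w a / r a - y a)
  rw [← hrr a]
  field_simp

end Projection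

/-! ### Reduced forms -/

section ReducedForm

variable {m : ℕ} {T : Fin m → Type*}

theorem prod_nonneg_of_nonneg {p : ∀ i, T i → ℝ} (hp : ∀ i A, 0 ≤ p i A) (t : ∀ j, T j) :
    0 ≤ ∏ j, p j (t j) :=
  Finset.prod_nonneg fun j _ => hp j (t j)

theorem Mechanism.alloc_le_one (M : Mechanism T) (t : ∀ j, T j) (i : Fin m) : M.alloc t i ≤ 1 :=
  (Finset.single_le_sum (fun j _ => M.nonneg t j) (Finset.mem_univ i)).trans (M.sum_le_one t)

variable [∀ i, Fintype (T i)]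

/-- Overwriting the report of bidder `i` by an independent draw from `p i` does not change the
distribution of the type profile. -/
theorem sum_mul_sum_update (p : ∀ i, T i → ℝ) (i : Fin m) (hp : ∑ A, p i A = 1)
    (f : (∀ j, T j) → ℝ) :
    ∑ A, p i A * ∑ t : (∀ j, T j), (∏ j, p j (t j)) * f (Function.update t i A) =
      ∑ t : (∀ j, T j), (∏ j, p j (t j)) * f t := by
  simp_rw [Finset.mul_sum]
  rw [← Fintype.sum_prod_type']
  -- Exchanging the drawn type `A` with the report `t i` is an involution that preserves weights.
  let e : T i × (∀ j, T j) → T i × (∀ j, T j) := fun x => (x.2 i, Function.update x.2 i x.1)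
  have he : Function.Involutive e := fun x => by simp [e]
  have hw : ∀ x : T i × (∀ j, T j), p i x.1 * ∏ j, p j (x.2 j) =
      p i (e x).1 * ∏ j, p j ((e x).2 j) := by
    rintro ⟨A, t⟩
    simp only [e]
    rw [← Finset.mul_prod_erase _ _ (Finset.mem_univ i),
      ← Finset.mul_prod_erase _ (fun j => p j (Function.update t i A j)) (Finset.mem_univ i)]
    have hrest : ∏ j ∈ Finset.univ.erase i, p j (Function.update t i A j) =
        ∏ j ∈ Finset.univ.erase i, p j (t j) :=
      Finset.prod_congr rfl fun j hj => by rw [Function.update_of_ne (Finset.ne_of_mem_erase hj)]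
    rw [hrest, Function.update_self]
    ring
  calc ∑ x : T i × (∀ j, T j), p i x.1 * ((∏ j, p j (x.2 j)) * f (Function.update x.2 i x.1))
      = ∑ x : T i × (∀ j, T j), p i (e x).1 * (∏ j, p j ((e x).2 j)) * f (e x).2 :=
        Finset.sum_congr rfl fun x _ => by rw [← mul_assoc, hw x]
    _ = ∑ x : T i × (∀ j, T j), p i x.1 * (∏ j, p j (x.2 j)) * f x.2 :=
        Equiv.sum_comp he.toPerm
          (fun x : T i × (∀ j, T j) => p i x.1 * (∏ j, p j (x.2 j)) * f x.2)
    _ = ∑ t : (∀ j, T j), (∏ j, p j (t j)) * f t := by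
        rw [Fintype.sum_prod_type]
        simp_rw [mul_assoc, ← Finset.mul_sum, ← Finset.sum_mul]
        rw [hp, one_mul]

/-- The expected value generated by a mechanism, computed from its reduced form. -/
theorem sum_mul_reducedForm {p : ∀ i, T i → ℝ} (hp : ∀ i, ∑ A, p i A = 1) (v : ∀ i, T i → ℝ)
    (M : Mechanism T) :
    ∑ i, ∑ A, p i A * v i A * M.reducedForm p i A =
      ∑ t : (∀ j, T j), (∏ j, p j (t j)) * ∑ i, v i (t i) * M.alloc t i := by
  simp_rw [Finset.mul_sum (s := Finset.univ (α := Fin m))]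
  rw [Finset.sum_comm (s := Finset.univ (α := ∀ j, T j))]
  refine Finset.sum_congr rfl fun i _ => ?_
  rw [← sum_mul_sum_update p i (hp i) (fun t => v i (t i) * M.alloc t i)]
  refine Finset.sum_congr rfl fun A _ => ?_
  rw [Mechanism.reducedForm, mul_assoc, Finset.mul_sum]
  congr 1
  refine Finset.sum_congr rfl fun t _ => ?_
  rw [Function.update_self]
  ring

theorem sum_prod_eq_one {p : ∀ i, T i → ℝ} (hp : ∀ i, ∑ A, p i A = 1) :
    ∑ t : (∀ j, T j), ∏ j, p j (t j) = 1 := by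
  rw [← Fintype.prod_sum]
  exact Finset.prod_eq_one fun i _ => hp i

theorem Mechanism.reducedForm_nonneg {p : ∀ i, T i → ℝ} (hp : ∀ i A, 0 ≤ p i A)
    (M : Mechanism T) (i : Fin m) (A : T i) : 0 ≤ M.reducedForm p i A :=
  Finset.sum_nonneg fun t _ => mul_nonneg (prod_nonneg_of_nonneg hp t) (M.nonneg _ _)

theorem Mechanism.reducedForm_le_one {p : ∀ i, T i → ℝ} (hp : ∀ i, p i ∈ stdSimplex ℝ (T i))
    (M : Mechanism T) (i : Fin m) (A : T i) : M.reducedForm p i A ≤ 1 := by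
  rw [← sum_prod_eq_one fun i => (hp i).2]
  exact Finset.sum_le_sum fun t _ => mul_le_of_le_one_right
    (prod_nonneg_of_nonneg (fun i => (hp i).1) t) (M.alloc_le_one _ _)

theorem Mechanism.isFeasible_reducedForm {p : ∀ i, T i → ℝ} (hp : ∀ i, p i ∈ stdSimplex ℝ (T i))
    (M : Mechanism T) : IsFeasible p (M.reducedForm p) :=
  ⟨fun i A => ⟨M.reducedForm_nonneg (fun i => (hp i).1) i A, M.reducedForm_le_one hp i A⟩,
    M, fun _ _ => le_rfl⟩

theorem Mechanism.reducedForm_mixture (p : ∀ i, T i → ℝ) {κ : Type*} (s : Finset κ) (q : κ → ℝ)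
    (hq : ∀ k ∈ s, 0 ≤ q k) (hq1 : ∑ k ∈ s, q k = 1) (M : κ → Mechanism T) :
    (Mechanism.mixture s q hq hq1 M).reducedForm p = ∑ k ∈ s, q k • (M k).reducedForm p := by
  ext i A
  simp only [Mechanism.reducedForm, Mechanism.mixture, Finset.sum_apply, Pi.smul_apply,
    smul_eq_mul, Finset.mul_sum]
  rw [Finset.sum_comm]
  exact Finset.sum_congr rfl fun k _ => Finset.sum_congr rfl fun t _ => by ring

theorem convex_range_reducedForm (p : ∀ i, T i → ℝ) :
    Convex ℝ (Set.range fun M : Mechanism T => M.reducedForm p) := by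
  rintro _ ⟨M, rfl⟩ _ ⟨M', rfl⟩ a b ha hb hab
  have h0 : ∀ k ∈ (Finset.univ : Finset Bool), 0 ≤ cond k a b := fun k _ => by
    cases k
    exacts [hb, ha]
  have h1 : ∑ k, cond k a b = 1 := by rw [Fintype.sum_bool]; exact hab
  refine ⟨Mechanism.mixture Finset.univ _ h0 h1 fun k => cond k M M',
    (Mechanism.reducedForm_mixture p _ _ h0 h1 _).trans ?_⟩
  rw [Fintype.sum_bool]
  rfl

theorem continuous_reducedForm (M : Mechanism T) (i : Fin m) (A : T i) :
    Continuous fun p : ∀ i, T i → ℝ => M.reducedForm p i A := by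
  unfold Mechanism.reducedForm
  fun_prop

end ReducedForm

/-! ### Hierarchical mechanisms -/

namespace HierarchicalMechanism

variable {m : ℕ} {T : Fin m → Type*} [∀ i, Fintype (T i)] {H : HierarchicalMechanism T}

theorem mem_winners {t : ∀ i, T i} {i : Fin m} :
    i ∈ H.winners t ↔ H ⟨i, t i⟩ ≠ ⊤ ∧ ∀ j, H ⟨i, t i⟩ ≤ H ⟨j, t j⟩ := by
  simp [winners]

/-- A strict hierarchical mechanism never has to break a tie. -/
theorem IsStrict.eq_of_mem_winners (hH : H.IsStrict) {t : ∀ i, T i} {i j : Fin m}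
    (hi : i ∈ H.winners t) (hj : j ∈ H.winners t) : i = j := by
  rw [mem_winners] at hi hj
  by_contra hij
  rcases hH i j (t i) (t j) hij with h | h
  · exact h (le_antisymm (hi.2 j) (hj.2 i))
  · exact hj.1 h.2

theorem IsStrict.alloc_eq (hH : H.IsStrict) (t : ∀ i, T i) (i : Fin m) :
    H.toMechanism.alloc t i = if i ∈ H.winners t then 1 else 0 := by
  simp only [toMechanism]
  split_ifs with hi
  · have : H.winners t = {i} :=
      Finset.eq_singleton_iff_unique_mem.2 ⟨hi, fun j hj => hH.eq_of_mem_winners hj hi⟩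
    simp [this]
  · rfl

theorem IsStrict.alloc_of_mem (hH : H.IsStrict) {t : ∀ i, T i} {i : Fin m}
    (hi : i ∈ H.winners t) : H.toMechanism.alloc t = Pi.single i 1 := by
  ext j
  rw [hH.alloc_eq]
  by_cases hj : j = i
  · subst hj; simp [hi]
  · rw [if_neg fun h => hj (hH.eq_of_mem_winners h hi), Pi.single_eq_of_ne hj]

theorem alloc_of_winners_eq_empty {t : ∀ i, T i} (ht : H.winners t = ∅) :
    H.toMechanism.alloc t = 0 := by
  ext j
  simp [toMechanism, ht]

theorem eq_top_of_winners_eq_empty {t : ∀ i, T i} (ht : H.winners t = ∅) (i : Fin m) :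
    H ⟨i, t i⟩ = ⊤ := by
  by_contra hi
  obtain ⟨k, -, hk⟩ := Finset.exists_min_image Finset.univ (fun j => H ⟨j, t j⟩)
    ⟨i, Finset.mem_univ i⟩
  have : k ∈ H.winners t := mem_winners.2
    ⟨((hk i (Finset.mem_univ i)).trans_lt (lt_top_iff_ne_top.2 hi)).ne,
      fun j => hk j (Finset.mem_univ j)⟩
  simp [ht] at this

/-- A type on a smaller level wins at least as often. -/
theorem IsStrict.reducedForm_le (hH : H.IsStrict) {p : ∀ i, T i → ℝ} (hp : ∀ i A, 0 ≤ p i A)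
    {i : Fin m} {A A' : T i} (h : H ⟨i, A⟩ ≤ H ⟨i, A'⟩) :
    H.toMechanism.reducedForm p i A' ≤ H.toMechanism.reducedForm p i A := by
  refine Finset.sum_le_sum fun t _ => mul_le_mul_of_nonneg_left ?_ (prod_nonneg_of_nonneg hp t)
  rw [hH.alloc_eq, hH.alloc_eq]
  by_cases hi : i ∈ H.winners (Function.update t i A')
  · rw [if_pos hi, if_pos]
    rw [mem_winners, Function.update_self] at hi ⊢
    refine ⟨(h.trans_lt (lt_top_iff_ne_top.2 hi.1)).ne, fun j => ?_⟩
    by_cases hj : j = i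
    · subst hj; rw [Function.update_self]
    · have := hi.2 j
      rw [Function.update_of_ne hj] at this ⊢
      exact h.trans this
  · rw [if_neg hi]
    split_ifs <;> norm_num

theorem reducedForm_eq_zero_of_eq_top (p : ∀ i, T i → ℝ) {i : Fin m} {A : T i}
    (h : H ⟨i, A⟩ = ⊤) : H.toMechanism.reducedForm p i A = 0 := by
  refine Finset.sum_eq_zero fun t _ => ?_
  have : i ∉ H.winners (Function.update t i A) := fun hi => by
    rw [mem_winners, Function.update_self] at hi
    exact hi.1 h
  simp [toMechanism, this]

section OfKey

variable {L : Type*} [LinearOrder L]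

open Classical in
/-- The hierarchical mechanism that ranks types by a key, larger keys on smaller levels, and puts
the types outside of `S` on the level LOSE.  The level of a type is the number of types with a
larger key. -/
noncomputable def ofKey (key : (Σ i, T i) → L) (S : Set (Σ i, T i)) : HierarchicalMechanism T :=
  fun a => if a ∈ S then
    (↑(⟨(Finset.univ.filter fun b => key a < key b).card, by
      rw [← Fintype.card_sigma, ← Finset.card_univ]
      exact Finset.card_lt_card ⟨Finset.filter_subset _ _, fun h => by
        simpa using h (Finset.mem_univ a)⟩⟩ : Fin (∑ i, Fintype.card (T i))) :
      WithTop (Fin (∑ i, Fintype.card (T i)))) else ⊤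

variable {key : (Σ i, T i) → L} {S : Set (Σ i, T i)} {a b : Σ i, T i}

theorem ofKey_eq_top_iff : ofKey key S a = ⊤ ↔ a ∉ S := by
  unfold ofKey
  split_ifs with h <;> simp [h]

theorem ofKey_le_of_key_le (h : key b ≤ key a) (hS : b ∈ S → a ∈ S) :
    ofKey key S a ≤ ofKey key S b := by
  by_cases hb : b ∈ S
  · simp only [ofKey, if_pos hb, if_pos (hS hb), WithTop.coe_le_coe, Fin.mk_le_mk]
    exact Finset.card_le_card fun c hc => by
      simp only [Finset.mem_filter, Finset.mem_univ, true_and] at hc ⊢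
      exact h.trans_lt hc
  · rw [ofKey_eq_top_iff.2 hb]
    exact le_top

theorem ofKey_lt_of_key_lt (h : key b < key a) (ha : a ∈ S) :
    ofKey key S a < ofKey key S b := by
  by_cases hb : b ∈ S
  · simp only [ofKey, if_pos hb, if_pos ha, WithTop.coe_lt_coe, Fin.mk_lt_mk]
    refine Finset.card_lt_card ⟨fun c hc => ?_, fun hsub => ?_⟩
    · simp only [Finset.mem_filter, Finset.mem_univ, true_and] at hc ⊢
      exact h.trans hc
    · have := @hsub a (by simpa using h)
      simp at this
  · rw [ofKey_eq_top_iff.2 hb, lt_top_iff_ne_top, Ne, ofKey_eq_top_iff, not_not]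
    exact ha

theorem isStrict_ofKey (hkey : ∀ (i j : Fin m) (A : T i) (B : T j), i ≠ j →
    key ⟨i, A⟩ ≠ key ⟨j, B⟩) : (ofKey key S).IsStrict := by
  intro i j A B hij
  by_cases hA : (⟨i, A⟩ : Σ i, T i) ∈ S
  · left
    by_cases hB : (⟨j, B⟩ : Σ i, T i) ∈ S
    · rcases lt_or_gt_of_ne (hkey i j A B hij) with h | h
      · exact (ofKey_lt_of_key_lt h hB).ne'
      · exact (ofKey_lt_of_key_lt h hA).ne
    · rw [ofKey_eq_top_iff.2 hB, Ne, ofKey_eq_top_iff, not_not]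
      exact hA
  · by_cases hB : (⟨j, B⟩ : Σ i, T i) ∈ S
    · left
      rw [ofKey_eq_top_iff.2 hA]
      exact fun h => ofKey_eq_top_iff.1 h.symm hB
    · right
      rw [ofKey_eq_top_iff.2 hA, ofKey_eq_top_iff.2 hB]
      exact ⟨rfl, rfl⟩

end OfKey

end HierarchicalMechanism

/-! ### Maximizing linear objectives -/

section Optimization

variable {m : ℕ} {T : Fin m → Type*}

/-- The cone of nonnegative vectors that are monotone with respect to a ranking `ρ` of the types of
each bidder. -/
def monotoneCone (ρ : ∀ i, T i → ℝ) : Set ((Σ i, T i) → ℝ) :=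
  {x | (∀ a, 0 ≤ x a) ∧ ∀ i A A', ρ i A' ≤ ρ i A → x ⟨i, A'⟩ ≤ x ⟨i, A⟩}

theorem isClosed_monotoneCone (ρ : ∀ i, T i → ℝ) : IsClosed (monotoneCone ρ) := by
  simp only [monotoneCone, Set.ofPred_and, Set.ofPred_forall]
  refine (isClosed_iInter fun a => isClosed_le continuous_const (continuous_apply a)).inter
    (isClosed_iInter fun i => isClosed_iInter fun A => isClosed_iInter fun A' =>
      isClosed_iInter fun _ => isClosed_le (continuous_apply _) (continuous_apply _))

theorem convex_monotoneCone (ρ : ∀ i, T i → ℝ) : Convex ℝ (monotoneCone ρ) := by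
  rintro x ⟨hx0, hx⟩ y ⟨hy0, hy⟩ a b ha hb -
  refine ⟨fun c => add_nonneg (mul_nonneg ha (hx0 c)) (mul_nonneg hb (hy0 c)), fun i A A' h => ?_⟩
  exact add_le_add (mul_le_mul_of_nonneg_left (hx i A A' h) ha)
    (mul_le_mul_of_nonneg_left (hy i A A' h) hb)

theorem zero_mem_monotoneCone (ρ : ∀ i, T i → ℝ) : 0 ∈ monotoneCone ρ :=
  ⟨fun _ => le_rfl, fun _ _ _ _ => le_rfl⟩

theorem add_mem_monotoneCone {ρ : ∀ i, T i → ℝ} {x y : (Σ i, T i) → ℝ}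
    (hx : x ∈ monotoneCone ρ) (hy : y ∈ monotoneCone ρ) : x + y ∈ monotoneCone ρ :=
  ⟨fun a => add_nonneg (hx.1 a) (hy.1 a), fun i A A' h => add_le_add (hx.2 i A A' h)
    (hy.2 i A A' h)⟩

variable [∀ i, Fintype (T i)]

/-- Among all mechanisms, ranking the types by their values `v ≥ 0` (and discarding those of value
`0`) generates the largest value on every type profile. -/
theorem HierarchicalMechanism.sum_mul_alloc_le {H : HierarchicalMechanism T} {v : ∀ i, T i → ℝ}
    (hH : H.IsStrict) (hv0 : ∀ i A, 0 ≤ v i A) (htop : ∀ i A, H ⟨i, A⟩ = ⊤ → v i A = 0)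
    (hle : ∀ i j A B, H ⟨i, A⟩ ≤ H ⟨j, B⟩ → v j B ≤ v i A) (M : Mechanism T) (t : ∀ i, T i) :
    ∑ i, v i (t i) * M.alloc t i ≤ ∑ i, v i (t i) * H.toMechanism.alloc t i := by
  rcases (H.winners t).eq_empty_or_nonempty with h | ⟨k, hk⟩
  · have hz : ∀ i, v i (t i) = 0 := fun i => htop i _ (eq_top_of_winners_eq_empty h i)
    simp [hz]
  · rw [hH.alloc_of_mem hk]
    calc ∑ i, v i (t i) * M.alloc t i ≤ ∑ i, v k (t k) * M.alloc t i :=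
          Finset.sum_le_sum fun i _ => mul_le_mul_of_nonneg_right
            (hle _ _ _ _ ((mem_winners.1 hk).2 i)) (M.nonneg t i)
      _ ≤ v k (t k) := by
          rw [← Finset.mul_sum]
          exact mul_le_of_le_one_right (hv0 _ _) (M.sum_le_one t)
      _ = ∑ i, v i (t i) * (Pi.single k 1 : Fin m → ℝ) i := by
          simp [Pi.single_apply]

/-- If `x` vanishes where `v` does and is constant where `v` is, then a small multiple of `x` may be
subtracted from `v` without leaving the cone: only finitely many strict inequalities have to
survive. -/
theorem exists_pos_sub_smul_mem_monotoneCone {ρ : ∀ i, T i → ℝ} {v x : (Σ i, T i) → ℝ}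
    (hv : v ∈ monotoneCone ρ) (h0 : ∀ a, v a = 0 → x a = 0)
    (heq : ∀ i A A', v ⟨i, A⟩ = v ⟨i, A'⟩ → x ⟨i, A⟩ = x ⟨i, A'⟩) :
    ∃ ε : ℝ, 0 < ε ∧ v - ε • x ∈ monotoneCone ρ := by
  have hlim : ∀ c d : ℝ, Filter.Tendsto (fun ε : ℝ => c - ε * d) (nhdsWithin 0 (Set.Ioi 0))
      (nhds c) := fun c d => by
    have : Continuous fun ε : ℝ => c - ε * d := by fun_prop
    simpa using (this.tendsto 0).mono_left nhdsWithin_le_nhds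
  have h1 : ∀ᶠ ε : ℝ in nhdsWithin 0 (Set.Ioi 0), ∀ a, 0 ≤ v a - ε * x a := by
    refine Filter.eventually_all.2 fun a => ?_
    rcases (hv.1 a).eq_or_lt with h | h
    · simp [← h, h0 a h.symm]
    · exact ((hlim _ _).eventually (eventually_gt_nhds h)).mono fun _ h => h.le
  have h2 : ∀ᶠ ε : ℝ in nhdsWithin 0 (Set.Ioi 0), ∀ i, ∀ A A' : T i, ρ i A' ≤ ρ i A →
      v ⟨i, A'⟩ - ε * x ⟨i, A'⟩ ≤ v ⟨i, A⟩ - ε * x ⟨i, A⟩ := by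
    refine Filter.eventually_all.2 fun i => Filter.eventually_all.2 fun A =>
      Filter.eventually_all.2 fun A' => ?_
    by_cases hA : ρ i A' ≤ ρ i A
    · rcases (hv.2 i A A' hA).eq_or_lt with h | h
      · rw [h, heq i A' A h]
        simp
      · exact ((hlim _ _).eventually_lt (hlim _ _) h).mono fun _ h _ => h.le
    · exact Filter.Eventually.of_forall fun _ h => absurd h hA
  have hpos : ∀ᶠ ε : ℝ in nhdsWithin 0 (Set.Ioi 0), 0 < ε := self_mem_nhdsWithin
  obtain ⟨ε, hε, h1, h2⟩ := (hpos.and (h1.and h2)).exists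
  exact ⟨ε, hε, h1, h2⟩

/-- Every linear objective over the feasible reduced forms that are monotone in a ranking `ρ` is
maximized by a strict hierarchical mechanism.  The objective `w` is replaced by the virtual values
`v`, the projection of `w / p` onto the monotone cone, which plays the role of ironing. -/
theorem exists_hierarchical_sum_le_of_pos {p : ∀ i, T i → ℝ} (hp : ∀ i, p i ∈ stdSimplex ℝ (T i))
    (hpos : ∀ i A, 0 < p i A) {ρ π : ∀ i, T i → ℝ} (hπ0 : ∀ i A, 0 ≤ π i A)
    (hπ : ∀ i A A', ρ i A' ≤ ρ i A → π i A' ≤ π i A) {M : Mechanism T} (hM : M.Implements p π)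
    (w : ∀ i, T i → ℝ) :
    ∃ H : HierarchicalMechanism T, H.IsStrict ∧ H.IsPartiallyOrdered ρ ∧
      ∑ i, ∑ A, w i A * π i A ≤ ∑ i, ∑ A, w i A * H.toMechanism.reducedForm p i A := by
  obtain ⟨v, hv, hproj⟩ := exists_mem_forall_sum_sub_mul_sub_le_zero
    ⟨0, zero_mem_monotoneCone ρ⟩ (isClosed_monotoneCone ρ) (convex_monotoneCone ρ)
    (p := fun a => p a.1 a.2) (fun a => hpos a.1 a.2) (fun a => w a.1 a.2)
  -- Ties in value between different bidders are broken in favour of the larger index.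
  let key : (Σ i, T i) → ℝ ×ₗ Fin m := fun a => toLex (v a, a.1)
  let H : HierarchicalMechanism T := HierarchicalMechanism.ofKey key {a | 0 < v a}
  have hS : H.IsStrict := HierarchicalMechanism.isStrict_ofKey fun i j A B hij h =>
    hij (congrArg (fun z => (ofLex z).2) h)
  have htop : ∀ a, H a = ⊤ ↔ v a = 0 := fun a => by
    rw [HierarchicalMechanism.ofKey_eq_top_iff, Set.mem_ofPred_eq, not_lt]
    exact ⟨fun h => h.antisymm (hv.1 a), fun h => h.le⟩
  have hHv : ∀ i (A A' : T i), v ⟨i, A'⟩ ≤ v ⟨i, A⟩ → H ⟨i, A⟩ ≤ H ⟨i, A'⟩ := fun i A A' h => by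
    refine HierarchicalMechanism.ofKey_le_of_key_le ?_ fun h' => lt_of_lt_of_le h' h
    rw [Prod.Lex.toLex_le_toLex]
    exact h.lt_or_eq.imp_right fun h => ⟨h, le_rfl⟩
  have hvH : ∀ i j A B, H ⟨i, A⟩ ≤ H ⟨j, B⟩ → v ⟨j, B⟩ ≤ v ⟨i, A⟩ := fun i j A B h => by
    by_contra! hlt
    refine h.not_gt (HierarchicalMechanism.ofKey_lt_of_key_lt ?_ ((hv.1 _).trans_lt hlt))
    rw [Prod.Lex.toLex_lt_toLex]
    exact Or.inl hlt
  have hp0 : ∀ i A, 0 ≤ p i A := fun i A => (hpos i A).le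
  set x : ∀ i, T i → ℝ := H.toMechanism.reducedForm p with hx
  have hxv : ∀ i (A A' : T i), v ⟨i, A'⟩ ≤ v ⟨i, A⟩ → x i A' ≤ x i A := fun i A A' h =>
    hS.reducedForm_le hp0 (hHv i A A' h)
  have hxK : (fun a : Σ i, T i => x a.1 a.2) ∈ monotoneCone ρ :=
    ⟨fun a => Mechanism.reducedForm_nonneg hp0 _ _ _, fun i A A' h => hxv i A A' (hv.2 i A A' h)⟩
  have hπK : (fun a : Σ i, T i => π a.1 a.2) ∈ monotoneCone ρ := ⟨fun a => hπ0 _ _, hπ⟩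
  have hcone : ∀ y : ∀ i, T i → ℝ, (fun a : Σ i, T i => y a.1 a.2) ∈ monotoneCone ρ →
      ∑ i, ∑ A, w i A * y i A ≤ ∑ i, ∑ A, p i A * v ⟨i, A⟩ * y i A := fun y hy => by
    have h := hproj _ (add_mem_monotoneCone hv hy)
    simp only [Pi.add_apply, add_sub_cancel_left, sub_mul, Finset.sum_sub_distrib,
      Fintype.sum_sigma] at h
    linarith
  have hxeq : ∑ i, ∑ A, p i A * v ⟨i, A⟩ * x i A ≤ ∑ i, ∑ A, w i A * x i A := by
    obtain ⟨ε, hε, hmem⟩ := exists_pos_sub_smul_mem_monotoneCone hv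
      (x := fun a : Σ i, T i => x a.1 a.2)
      (fun a h => HierarchicalMechanism.reducedForm_eq_zero_of_eq_top p ((htop a).2 h))
      (fun i A A' h => (hxv i A' A h.le).antisymm (hxv i A A' h.ge))
    have h := hproj _ hmem
    have h' : ∑ a : Σ i, T i, (w a.1 a.2 - p a.1 a.2 * v a) *
        ((v - ε • fun a : Σ i, T i => x a.1 a.2) a - v a) =
        ε * (∑ i, ∑ A, p i A * v ⟨i, A⟩ * x i A - ∑ i, ∑ A, w i A * x i A) := by
      rw [Fintype.sum_sigma]
      simp only [mul_sub, Finset.mul_sum, ← Finset.sum_sub_distrib]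
      refine Finset.sum_congr rfl fun i _ => Finset.sum_congr rfl fun A _ => ?_
      simp only [Pi.sub_apply, Pi.smul_apply, smul_eq_mul]
      ring
    rw [h'] at h
    have := nonpos_of_mul_nonpos_right h hε
    linarith
  refine ⟨H, hS, fun i A A' h => hHv i A A' (hv.2 i A A' h), ?_⟩
  calc ∑ i, ∑ A, w i A * π i A ≤ ∑ i, ∑ A, p i A * v ⟨i, A⟩ * π i A := hcone π hπK
    _ ≤ ∑ i, ∑ A, p i A * v ⟨i, A⟩ * M.reducedForm p i A :=
        Finset.sum_le_sum fun i _ => Finset.sum_le_sum fun A _ =>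
          mul_le_mul_of_nonneg_left (hM i A) (mul_nonneg (hp0 i A) (hv.1 _))
    _ ≤ ∑ i, ∑ A, p i A * v ⟨i, A⟩ * x i A := by
        rw [sum_mul_reducedForm (fun i => (hp i).2) (fun i A => v ⟨i, A⟩), hx,
          sum_mul_reducedForm (fun i => (hp i).2) (fun i A => v ⟨i, A⟩)]
        exact Finset.sum_le_sum fun t _ => mul_le_mul_of_nonneg_left
          (HierarchicalMechanism.sum_mul_alloc_le hS (fun i A => hv.1 _)
            (fun i A h => (htop _).1 h) hvH M t) (prod_nonneg_of_nonneg hp0 t)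
    _ ≤ ∑ i, ∑ A, w i A * x i A := hxeq

/-- The same without positivity of the probabilities.  They are perturbed towards the uniform
distributions, and the reduced form is lowered accordingly; as there are only finitely many
hierarchical mechanisms, one of them is optimal for arbitrarily small perturbations. -/
theorem exists_hierarchical_sum_le {p : ∀ i, T i → ℝ} (hp : ∀ i, p i ∈ stdSimplex ℝ (T i))
    {ρ π : ∀ i, T i → ℝ} (hπ0 : ∀ i A, 0 ≤ π i A)
    (hπ : ∀ i A A', ρ i A' ≤ ρ i A → π i A' ≤ π i A) {M : Mechanism T} (hM : M.Implements p π)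
    (w : ∀ i, T i → ℝ) :
    ∃ H : HierarchicalMechanism T, H.IsStrict ∧ H.IsPartiallyOrdered ρ ∧
      ∑ i, ∑ A, w i A * π i A ≤ ∑ i, ∑ A, w i A * H.toMechanism.reducedForm p i A := by
  have hT : ∀ i, Nonempty (T i) := fun i => by
    by_contra h
    rw [not_nonempty_iff] at h
    simpa using (hp i).2
  have hcard : ∀ i, (0 : ℝ) < Fintype.card (T i) := fun i => by
    exact_mod_cast Fintype.card_pos
  let P : ℝ → ∀ i, T i → ℝ := fun ε i A => (1 - ε) * p i A + ε * (Fintype.card (T i) : ℝ)⁻¹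
  let δ : ℝ → ℝ := fun ε => ∑ i, ∑ A, |M.reducedForm p i A - M.reducedForm (P ε) i A|
  let π' : ℝ → ∀ i, T i → ℝ := fun ε i A => max (π i A - δ ε) 0
  have hP : Continuous P := by fun_prop
  have hP0 : P 0 = p := by ext i A; simp [P]
  have hR : ∀ (M : Mechanism T) i A, Continuous fun ε => M.reducedForm (P ε) i A :=
    fun M i A => (continuous_reducedForm M i A).comp hP
  have hδ : Continuous δ := continuous_finsetSum _ fun i _ => continuous_finsetSum _ fun A _ =>
    (continuous_const.sub (hR M i A)).abs
  have hδ0 : δ 0 = 0 := by simp [δ, hP0]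
  have hπ'0 : π' 0 = π := by ext i A; simp [π', hδ0, hπ0 i A]
  have hcπ' : Continuous fun ε => ∑ i, ∑ A, w i A * π' ε i A := by fun_prop
  by_contra! hcon
  have hev : ∀ᶠ ε : ℝ in nhdsWithin 0 (Set.Ioi 0), ∀ H : HierarchicalMechanism T,
      H.IsStrict → H.IsPartiallyOrdered ρ → ∑ i, ∑ A, w i A * H.toMechanism.reducedForm (P ε) i A <
        ∑ i, ∑ A, w i A * π' ε i A := by
    refine Filter.eventually_all.2 fun H => ?_
    by_cases hH : H.IsStrict ∧ H.IsPartiallyOrdered ρ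
    · have hcH : Continuous fun ε => ∑ i, ∑ A, w i A * H.toMechanism.reducedForm (P ε) i A :=
        continuous_finsetSum _ fun i _ => continuous_finsetSum _ fun A _ =>
          continuous_const.mul (hR _ i A)
      have h0 : ∑ i, ∑ A, w i A * H.toMechanism.reducedForm (P 0) i A <
          ∑ i, ∑ A, w i A * π' 0 i A := by
        rw [hP0, hπ'0]
        exact hcon H hH.1 hH.2
      exact (((hcH.tendsto 0).eventually_lt (hcπ'.tendsto 0) h0).filter_mono
        nhdsWithin_le_nhds).mono fun _ h _ _ => h
    · exact Filter.Eventually.of_forall fun _ h1 h2 => absurd ⟨h1, h2⟩ hH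
  have hpos : ∀ᶠ ε : ℝ in nhdsWithin 0 (Set.Ioi 0), 0 < ε := self_mem_nhdsWithin
  have hlt1 : ∀ᶠ ε : ℝ in nhdsWithin 0 (Set.Ioi 0), ε < 1 :=
    nhdsWithin_le_nhds (eventually_lt_nhds zero_lt_one)
  obtain ⟨ε, hε, hε1, hlt⟩ := (hpos.and (hlt1.and hev)).exists
  have hPpos : ∀ i A, 0 < P ε i A := fun i A => add_pos_of_nonneg_of_pos
    (mul_nonneg (sub_nonneg.2 hε1.le) ((hp i).1 A)) (mul_pos hε (inv_pos.2 (hcard i)))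
  have hPs : ∀ i, P ε i ∈ stdSimplex ℝ (T i) := fun i => by
    refine ⟨fun A => (hPpos i A).le, ?_⟩
    simp only [P, Finset.sum_add_distrib, ← Finset.mul_sum, (hp i).2, Finset.sum_const,
      Finset.card_univ, nsmul_eq_mul]
    rw [mul_inv_cancel₀ (hcard i).ne']
    ring
  have himp : M.Implements (P ε) (π' ε) := fun i A => by
    refine max_le ?_ (Mechanism.reducedForm_nonneg (fun i => (hPs i).1) M i A)
    have h1 : |M.reducedForm p i A - M.reducedForm (P ε) i A| ≤ δ ε :=
      (Finset.single_le_sum (f := fun A => |M.reducedForm p i A - M.reducedForm (P ε) i A|)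
        (fun A _ => abs_nonneg _) (Finset.mem_univ A)).trans
      (Finset.single_le_sum
        (f := fun i => ∑ A, |M.reducedForm p i A - M.reducedForm (P ε) i A|)
        (fun i _ => Finset.sum_nonneg fun A _ => abs_nonneg _) (Finset.mem_univ i))
    have h2 := hM i A
    have h3 := le_abs_self (M.reducedForm p i A - M.reducedForm (P ε) i A)
    linarith
  obtain ⟨H, hS, hO, hle⟩ := exists_hierarchical_sum_le_of_pos hPs hPpos (ρ := ρ) (π := π' ε)
    (fun i A => le_max_right _ _)
    (fun i A A' h => max_le_max (sub_le_sub_right (hπ i A A' h) _) le_rfl) himp w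
  exact (hlt H hS hO).not_ge hle

end Optimization

/-! ### Convex hulls of hierarchical reduced forms -/

variable {m : ℕ} {T : Fin m → Type*} [∀ i, Fintype (T i)]

/-- The reduced forms of the strict hierarchical mechanisms that are partially ordered with respect
to `ρ`. -/
def hierarchicalForms (p ρ : ∀ i, T i → ℝ) : Set (∀ i, T i → ℝ) :=
  (fun H : HierarchicalMechanism T => H.toMechanism.reducedForm p) ''
    {H | H.IsStrict ∧ H.IsPartiallyOrdered ρ}

theorem finite_hierarchicalForms (p ρ : ∀ i, T i → ℝ) : (hierarchicalForms p ρ).Finite :=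
  (Set.toFinite _).image _

theorem eq_sum_smul_single [∀ i, DecidableEq (T i)] (x : ∀ i, T i → ℝ) :
    x = ∑ i, ∑ A, x i A • (Pi.single i (Pi.single A 1) : ∀ i, T i → ℝ) := by
  ext j B
  simp only [Finset.sum_apply, Pi.smul_apply, smul_eq_mul]
  rw [Finset.sum_eq_single j (fun i _ hij => Finset.sum_eq_zero fun A _ => by
    rw [Pi.single_eq_of_ne hij.symm, Pi.zero_apply, mul_zero]) (by simp)]
  simp [Pi.single_apply]

theorem linearMap_apply_eq_sum [∀ i, DecidableEq (T i)] (f : (∀ i, T i → ℝ) →ₗ[ℝ] ℝ)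
    (x : ∀ i, T i → ℝ) :
    f x = ∑ i, ∑ A, f (Pi.single i (Pi.single A 1)) * x i A := by
  conv_lhs => rw [eq_sum_smul_single x]
  simp [mul_comm]

/-- A feasible reduced form that is monotone in `ρ` lies in the convex hull of the reduced forms of
hierarchical mechanisms: no linear functional separates it from them. -/
theorem IsFeasible.mem_convexHull {p : ∀ i, T i → ℝ} (hp : ∀ i, p i ∈ stdSimplex ℝ (T i))
    {ρ π : ∀ i, T i → ℝ} (hfeas : IsFeasible p π)
    (hπ : ∀ i A A', ρ i A' ≤ ρ i A → π i A' ≤ π i A) :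
    π ∈ convexHull ℝ (hierarchicalForms p ρ) := by
  classical
  obtain ⟨h01, M, hM⟩ := hfeas
  by_contra hcon
  obtain ⟨f, u, hf, hu⟩ := geometric_hahn_banach_closed_point (convex_convexHull ℝ _)
    ((finite_hierarchicalForms p ρ).isClosed_convexHull ℝ) hcon
  obtain ⟨H, hS, hO, hle⟩ := exists_hierarchical_sum_le hp (ρ := ρ) (fun i A => (h01 i A).1) hπ hM
    (fun i A => f (Pi.single i (Pi.single A 1)))
  have h1 := linearMap_apply_eq_sum f.toLinearMap π
  have h2 := linearMap_apply_eq_sum f.toLinearMap (H.toMechanism.reducedForm p)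
  have h3 := hf _ (subset_convexHull ℝ _ ⟨H, ⟨hS, hO⟩, rfl⟩)
  simp only [ContinuousLinearMap.coe_coe] at h1 h2
  linarith

theorem convexHull_hierarchicalForms_subset_range (p ρ : ∀ i, T i → ℝ) :
    convexHull ℝ (hierarchicalForms p ρ) ⊆ Set.range fun M : Mechanism T => M.reducedForm p := by
  refine convexHull_min ?_ (convex_range_reducedForm p)
  rintro _ ⟨H, -, rfl⟩
  exact ⟨H.toMechanism, rfl⟩

theorem finrank_reducedForms : Module.finrank ℝ (∀ i, T i → ℝ) = ∑ i, Fintype.card (T i) := by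
  simp [Module.finrank_pi_fintype]

/-- By Carathéodory's theorem, few hierarchical mechanisms suffice for a given convex
combination. -/
theorem exists_mixture_of_mem_convexHull {p ρ π : ∀ i, T i → ℝ}
    (h : π ∈ convexHull ℝ (hierarchicalForms p ρ)) :
    ∃ (s : Finset (HierarchicalMechanism T)) (q : HierarchicalMechanism T → ℝ)
      (hq : ∀ H ∈ s, 0 ≤ q H) (hq1 : ∑ H ∈ s, q H = 1),
      s.card ≤ (∑ i, Fintype.card (T i)) + 1 ∧
      (∀ H ∈ s, H.IsStrict ∧ H.IsPartiallyOrdered ρ) ∧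
      (Mechanism.mixture s q hq hq1 fun H => H.toMechanism).ExactlyImplements p π := by
  classical
  rw [convexHull_eq_union] at h
  simp only [Set.mem_iUnion] at h
  obtain ⟨t, hts, hind, ht⟩ := h
  obtain ⟨w, hw0, hw1, rfl⟩ := Finset.mem_convexHull'.1 ht
  choose! g hg using fun x (hx : x ∈ hierarchicalForms p ρ) => hx
  have hinj : Set.InjOn g t := fun x hx y hy hxy => by
    rw [← (hg x (hts hx)).2, ← (hg y (hts hy)).2, hxy]
  have hsum : ∑ H ∈ t.image g, w (H.toMechanism.reducedForm p) = 1 := by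
    rw [Finset.sum_image hinj, ← hw1]
    exact Finset.sum_congr rfl fun x hx => congrArg w (hg x (hts hx)).2
  refine ⟨t.image g, fun H => w (H.toMechanism.reducedForm p), ?_, hsum, ?_, ?_, ?_⟩
  · refine Finset.forall_mem_image.2 fun x hx => ?_
    exact (hw0 x hx).trans_eq (congrArg w (hg x (hts hx)).2.symm)
  · refine Finset.card_image_le.trans ?_
    have := hind.card_le_finrank_succ
    rw [Fintype.card_coe] at this
    refine this.trans (Nat.succ_le_succ ?_)
    rw [← finrank_reducedForms (T := T)]
    exact Submodule.finrank_le _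
  · exact Finset.forall_mem_image.2 fun x hx => (hg x (hts hx)).1
  · intro i A
    rw [Mechanism.reducedForm_mixture, Finset.sum_image hinj]
    refine congrFun (congrFun (Finset.sum_congr rfl fun x hx => ?_) i) A
    rw [show (g x).toMechanism.reducedForm p = x from (hg x (hts hx)).2]

/-! ### Extreme points -/

section Exposed

/-- If `k` is the only index with the largest weight `v k > 0`, then among the vectors `φ ≥ 0` with
`∑ φ ≤ 1` the unit vector at `k` is the only maximizer of the weighted sum. -/
theorem sum_mul_le_and_eq_single {ι : Type*} [Fintype ι] [DecidableEq ι] {v φ : ι → ℝ} {k : ι}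
    (hk : 0 < v k) (hv : ∀ j, j ≠ k → v j < v k) (h0 : ∀ i, 0 ≤ φ i) (h1 : ∑ i, φ i ≤ 1) :
    ∑ i, v i * φ i ≤ v k ∧ (v k ≤ ∑ i, v i * φ i → φ = Pi.single k 1) := by
  have hid : v k - ∑ i, v i * φ i = v k * (1 - ∑ i, φ i) + ∑ i, (v k - v i) * φ i := by
    simp only [sub_mul, Finset.sum_sub_distrib, ← Finset.mul_sum]
    ring
  have hvk : ∀ i, 0 ≤ v k - v i := fun i => by
    rcases eq_or_ne i k with rfl | h
    · simp
    · exact sub_nonneg.2 (hv i h).le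
  have hnn : ∀ i ∈ Finset.univ, 0 ≤ (v k - v i) * φ i := fun i _ => mul_nonneg (hvk i) (h0 i)
  have ha : 0 ≤ v k * (1 - ∑ i, φ i) := mul_nonneg hk.le (sub_nonneg.2 h1)
  have hb := Finset.sum_nonneg hnn
  refine ⟨by linarith, fun hle => ?_⟩
  have hb0 : ∑ i, (v k - v i) * φ i = 0 := by linarith
  have ha0 : v k * (1 - ∑ i, φ i) = 0 := by linarith
  have hφ : ∀ i, i ≠ k → φ i = 0 := fun i hi =>
    (mul_eq_zero.1 ((Finset.sum_eq_zero_iff_of_nonneg hnn).1 hb0 i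
      (Finset.mem_univ i))).resolve_left (sub_pos.2 (hv i hi)).ne'
  have hφk : φ k = 1 := by
    have h := (mul_eq_zero.1 ha0).resolve_left hk.ne'
    rw [Finset.sum_eq_single k (fun i _ hi => hφ i hi) (by simp)] at h
    linarith
  ext i
  rcases eq_or_ne i k with rfl | hi
  · simp [hφk]
  · simp [hφ i hi, hi]

namespace HierarchicalMechanism

/-- A value function for which `H` is the unique optimal allocation rule: values decrease strictly
with the level, are positive on the proper levels, and negative on LOSE. -/
def levelValue (H : HierarchicalMechanism T) (i : Fin m) (A : T i) : ℝ :=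
  match H ⟨i, A⟩ with
  | ⊤ => -1
  | WithTop.some l => (∑ i, Fintype.card (T i) : ℕ) - (l : ℕ)

variable {H : HierarchicalMechanism T}

theorem levelValue_of_eq_top {i : Fin m} {A : T i} (h : H ⟨i, A⟩ = ⊤) : H.levelValue i A = -1 := by
  unfold levelValue
  rw [h]

theorem levelValue_of_eq_coe {i : Fin m} {A : T i} {l : Fin (∑ i, Fintype.card (T i))}
    (h : H ⟨i, A⟩ = l) : H.levelValue i A = (∑ i, Fintype.card (T i) : ℕ) - (l : ℕ) := by
  unfold levelValue
  rw [h]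

theorem levelValue_pos {i : Fin m} {A : T i} (h : H ⟨i, A⟩ ≠ ⊤) : 0 < H.levelValue i A := by
  obtain ⟨l, hl⟩ := WithTop.ne_top_iff_exists.1 h
  rw [levelValue_of_eq_coe hl.symm, sub_pos, Nat.cast_lt]
  exact l.2

theorem levelValue_lt_of_lt {i j : Fin m} {A : T i} {B : T j} (h : H ⟨i, A⟩ < H ⟨j, B⟩) :
    H.levelValue j B < H.levelValue i A := by
  obtain ⟨l, hl⟩ := WithTop.ne_top_iff_exists.1 (h.trans_le le_top).ne
  by_cases hB : H ⟨j, B⟩ = ⊤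
  · rw [levelValue_of_eq_top hB]
    linarith [levelValue_pos (h.trans_le le_top).ne]
  · obtain ⟨k, hk⟩ := WithTop.ne_top_iff_exists.1 hB
    rw [levelValue_of_eq_coe hl.symm, levelValue_of_eq_coe hk.symm]
    rw [← hl, ← hk, WithTop.coe_lt_coe] at h
    exact sub_lt_sub_left (Nat.cast_lt.2 h) _

/-- On each profile, a strict `H` is the unique maximizer of the generated value. -/
theorem IsStrict.sum_levelValue_mul_alloc_le (hH : H.IsStrict) (M : Mechanism T) (t : ∀ i, T i) :
    ∑ i, H.levelValue i (t i) * M.alloc t i ≤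
        ∑ i, H.levelValue i (t i) * H.toMechanism.alloc t i ∧
      (∑ i, H.levelValue i (t i) * H.toMechanism.alloc t i ≤
        ∑ i, H.levelValue i (t i) * M.alloc t i → M.alloc t = H.toMechanism.alloc t) := by
  rcases (H.winners t).eq_empty_or_nonempty with h | ⟨k, hk⟩
  · have hz : ∀ i, H.levelValue i (t i) = -1 := fun i =>
      levelValue_of_eq_top (eq_top_of_winners_eq_empty h i)
    rw [alloc_of_winners_eq_empty h]
    simp only [hz, neg_one_mul, Finset.sum_neg_distrib, Pi.zero_apply, Finset.sum_const_zero,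
      neg_zero]
    have hnn := Finset.sum_nonneg fun j (_ : j ∈ Finset.univ) => M.nonneg t j
    refine ⟨by linarith, fun hle => ?_⟩
    have h0 : ∑ i, M.alloc t i = 0 := by linarith
    ext i
    exact (Finset.sum_eq_zero_iff_of_nonneg fun i _ => M.nonneg t i).1 h0 i (Finset.mem_univ i)
  · have hk' := mem_winners.1 hk
    have hmain := sum_mul_le_and_eq_single (v := fun i => H.levelValue i (t i)) (φ := M.alloc t)
      (k := k) (levelValue_pos hk'.1) (fun j hj => levelValue_lt_of_lt
        ((hk'.2 j).lt_of_ne fun heq => ?_)) (M.nonneg t) (M.sum_le_one t)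
    · rw [hH.alloc_of_mem hk]
      have hs : ∑ i, H.levelValue i (t i) * (Pi.single k 1 : Fin m → ℝ) i =
          H.levelValue k (t k) := by
        simp [Pi.single_apply]
      rw [hs]
      exact hmain
    · rcases hH k j (t k) (t j) hj.symm with h | h
      · exact h heq
      · exact hk'.1 (h.1.trans h.2)

/-- The expected level value exposes the reduced form of `H` among those of all mechanisms. -/
theorem IsStrict.reducedForm_mem_exposedPoints (hH : H.IsStrict) {p : ∀ i, T i → ℝ}
    (hp : ∀ i, p i ∈ stdSimplex ℝ (T i)) (hpos : ∀ i A, 0 < p i A) :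
    H.toMechanism.reducedForm p ∈
      (Set.range fun M : Mechanism T => M.reducedForm p).exposedPoints ℝ := by
  let f : (∀ i, T i → ℝ) →ₗ[ℝ] ℝ :=
    { toFun := fun x => ∑ i, ∑ A, p i A * H.levelValue i A * x i A
      map_add' := fun x y => by simp only [Pi.add_apply, mul_add, Finset.sum_add_distrib]
      map_smul' := fun c x => by
        simp only [Pi.smul_apply, smul_eq_mul, RingHom.id_apply, Finset.mul_sum]
        exact Finset.sum_congr rfl fun i _ => Finset.sum_congr rfl fun A _ => by ring }
  have hf : ∀ M : Mechanism T, f.toContinuousLinearMap (M.reducedForm p) =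
      ∑ t : (∀ j, T j), (∏ j, p j (t j)) * ∑ i, H.levelValue i (t i) * M.alloc t i := fun M =>
    sum_mul_reducedForm (fun i => (hp i).2) H.levelValue M
  refine ⟨⟨_, rfl⟩, f.toContinuousLinearMap, ?_⟩
  rintro _ ⟨M, rfl⟩
  have hppos : ∀ t : (∀ j, T j), 0 < ∏ j, p j (t j) := fun t =>
    Finset.prod_pos fun j _ => hpos j (t j)
  have hle := fun t => mul_le_mul_of_nonneg_left (hH.sum_levelValue_mul_alloc_le M t).1 (hppos t).le
  simp only [hf]
  refine ⟨Finset.sum_le_sum fun t _ => hle t, fun h => ?_⟩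
  have heq := (Finset.sum_eq_sum_iff_of_le fun t _ => hle t).1
    ((Finset.sum_le_sum fun t _ => hle t).antisymm h)
  have halloc : ∀ t, M.alloc t = H.toMechanism.alloc t := fun t =>
    (hH.sum_levelValue_mul_alloc_le M t).2
      (mul_left_cancel₀ (hppos t).ne' (heq t (Finset.mem_univ t))).ge
  ext i A
  simp only [Mechanism.reducedForm, halloc]

end HierarchicalMechanism

end Exposed

/-! ### Total orders on the type sets -/

section Orders

variable {p : ∀ i, T i → ℝ} (ord : ∀ i, LinearOrder (T i))

open Classical in
/-- The position of a type in the order on its type set: the number of smaller types. -/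
noncomputable def rank (i : Fin m) (A : T i) : ℝ :=
  (Finset.univ.filter fun B => (ord i).lt B A).card

variable {ord}

theorem rank_le_rank_iff {i : Fin m} {A A' : T i} :
    rank ord i A' ≤ rank ord i A ↔ (ord i).le A' A := by
  unfold rank
  rw [Nat.cast_le]
  constructor
  · intro h
    by_contra hlt
    refine h.not_gt (Finset.card_lt_card ⟨fun B hB => ?_, fun hsub => ?_⟩)
    · simp only [Finset.mem_filter, Finset.mem_univ, true_and] at hB ⊢
      exact lt_trans hB (not_le.1 hlt)
    · have := @hsub A (by simpa using not_le.1 hlt)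
      simp at this
  · intro h
    refine Finset.card_le_card fun B hB => ?_
    simp only [Finset.mem_filter, Finset.mem_univ, true_and] at hB ⊢
    exact lt_of_lt_of_le hB h

theorem HierarchicalMechanism.isPartiallyOrdered_rank_iff {H : HierarchicalMechanism T} :
    H.IsPartiallyOrdered (rank ord) ↔ H.IsPartiallyOrderedWrt ord := by
  simp only [IsPartiallyOrdered, IsPartiallyOrderedWrt, ge_iff_le, rank_le_rank_iff]

theorem reducedForm_mem_feasibleRespecting (hp : ∀ i, p i ∈ stdSimplex ℝ (T i))
    {H : HierarchicalMechanism T} (hS : H.IsStrict) (hO : H.IsPartiallyOrderedWrt ord) :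
    H.toMechanism.reducedForm p ∈ feasibleRespecting p ord :=
  ⟨H.toMechanism.isFeasible_reducedForm hp, fun i A A' h =>
    hS.reducedForm_le (fun i => (hp i).1) (hO i A A' h)⟩

theorem convex_feasibleRespecting :
    Convex ℝ (feasibleRespecting p ord) := by
  rintro x ⟨⟨hx, Mx, hMx⟩, hxo⟩ y ⟨⟨hy, My, hMy⟩, hyo⟩ a b ha hb hab
  obtain ⟨M, hM⟩ := convex_range_reducedForm p ⟨Mx, rfl⟩ ⟨My, rfl⟩ ha hb hab
  refine ⟨⟨fun i A => convex_Icc 0 1 (hx i A) (hy i A) ha hb hab, M, fun i A => ?_⟩,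
    fun i A A' h => ?_⟩
  · refine le_of_le_of_eq ?_ (congrFun (congrFun hM i) A).symm
    exact add_le_add (mul_le_mul_of_nonneg_left (hMx i A) ha)
      (mul_le_mul_of_nonneg_left (hMy i A) hb)
  · exact add_le_add (mul_le_mul_of_nonneg_left (hxo i A A' h) ha)
      (mul_le_mul_of_nonneg_left (hyo i A A' h) hb)

theorem feasibleRespecting_eq_convexHull (hp : ∀ i, p i ∈ stdSimplex ℝ (T i)) :
    feasibleRespecting p ord = convexHull ℝ (hierarchicalForms p (rank ord)) := by
  refine Set.Subset.antisymm (fun π hπ => ?_) (convexHull_min ?_ convex_feasibleRespecting)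
  · exact hπ.1.mem_convexHull hp fun i A A' h => hπ.2 i A A' (rank_le_rank_iff.1 h)
  · rintro _ ⟨H, ⟨hS, hO⟩, rfl⟩
    exact reducedForm_mem_feasibleRespecting hp hS
      (HierarchicalMechanism.isPartiallyOrdered_rank_iff.1 hO)

/-- The indicator of an upper set of types of one bidder is a feasible reduced form: the item is
offered to this bidder only. -/
theorem single_indicator_mem_feasibleRespecting (hp : ∀ i, p i ∈ stdSimplex ℝ (T i)) (i : Fin m)
    {U : Set (T i)} (hU : ∀ A A', (ord i).le A' A → A' ∈ U → A ∈ U) :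
    Pi.single i (U.indicator 1) ∈ feasibleRespecting p ord := by
  have hval : ∀ A, (U.indicator 1 : T i → ℝ) A ∈ Set.Icc (0 : ℝ) 1 := fun A => by
    by_cases h : A ∈ U <;> simp [h]
  let M : Mechanism T :=
    { alloc := fun t => Pi.single i (U.indicator 1 (t i))
      nonneg := fun t j => by
        rcases eq_or_ne j i with rfl | h
        · simpa using (hval _).1
        · simp [h]
      sum_le_one := fun t => by
        rw [Finset.sum_pi_single']
        simpa using (hval _).2 }
  have hM : M.reducedForm p = Pi.single i (U.indicator 1) := by
    ext j A
    simp only [Mechanism.reducedForm, M]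
    rcases eq_or_ne j i with rfl | h
    · simp only [Pi.single_eq_same, Function.update_self]
      rw [← Finset.sum_mul, sum_prod_eq_one fun i => (hp i).2, one_mul]
    · simp [h]
  refine ⟨hM ▸ M.isFeasible_reducedForm hp, fun j A A' h => ?_⟩
  rcases eq_or_ne j i with rfl | hj
  · rw [Pi.single_eq_same]
    by_cases hA : A' ∈ U
    · rw [Set.indicator_of_mem hA, Set.indicator_of_mem (hU A A' h hA)]
      rfl
    · rw [Set.indicator_of_notMem hA]
      exact (hval A).1
  · simp [hj]

/-- The feasible reduced forms that respect the orders have full dimension: the coordinate vector of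
a type is the difference of the indicators of two upper sets. -/
theorem vectorSpan_feasibleRespecting (hp : ∀ i, p i ∈ stdSimplex ℝ (T i)) :
    vectorSpan ℝ (feasibleRespecting p ord) = ⊤ := by
  refine Submodule.eq_top_iff'.2 fun x => ?_
  rw [eq_sum_smul_single x]
  refine Submodule.sum_mem _ fun i _ => Submodule.sum_mem _ fun A _ => Submodule.smul_mem _ _ ?_
  have h1 := single_indicator_mem_feasibleRespecting (ord := ord) hp i (U := Set.Ici A)
    fun _ _ h h' => le_trans h' h
  have h2 := single_indicator_mem_feasibleRespecting (ord := ord) hp i (U := Set.Ioi A)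
    fun _ _ h h' => lt_of_lt_of_le h' h
  have hd : (Pi.single A 1 : T i → ℝ) = (Set.Ici A).indicator 1 - (Set.Ioi A).indicator 1 := by
    refine funext fun B => ?_
    rcases lt_trichotomy A B with h | h | h
    · simp [Set.indicator, h, h.le, h.ne']
    · simp [Set.indicator, h]
    · simp [Set.indicator, h.not_ge, h.not_gt, h.ne]
  rw [hd, Pi.single_sub]
  exact vsub_mem_vectorSpan ℝ h1 h2

theorem extremePoints_feasibleRespecting (hp : ∀ i, p i ∈ stdSimplex ℝ (T i))
    (hpos : ∀ i A, 0 < p i A) :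
    (feasibleRespecting p ord).extremePoints ℝ = hierarchicalForms p (rank ord) := by
  rw [feasibleRespecting_eq_convexHull hp]
  refine Set.Subset.antisymm extremePoints_convexHull_subset ?_
  rintro _ ⟨H, hH, rfl⟩
  exact inter_extremePoints_subset_extremePoints_of_subset
    (convexHull_hierarchicalForms_subset_range p (rank ord))
    ⟨subset_convexHull ℝ _ ⟨H, hH, rfl⟩,
      exposedPoints_subset_extremePoints (hH.1.reducedForm_mem_exposedPoints hp hpos)⟩

end Orders

end SingleItem

theorem mainTheorem5 {m : ℕ} (T : Fin m → Type*) [∀ i, Fintype (T i)]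
    (p : ∀ i, T i → ℝ) (hp : ∀ i, p i ∈ stdSimplex ℝ (T i)) :
    -- every feasible reduced form is exactly implemented by a small distribution
    (∀ π : ∀ i, T i → ℝ, SingleItem.IsFeasible p π →
      ∃ (s : Finset (SingleItem.HierarchicalMechanism T))
        (q : SingleItem.HierarchicalMechanism T → ℝ)
        (hq : ∀ H ∈ s, 0 ≤ q H) (hq1 : ∑ H ∈ s, q H = 1),
        s.card ≤ (∑ i, Fintype.card (T i)) + 1 ∧
        (∀ H ∈ s, H.IsStrict ∧ H.IsPartiallyOrdered π) ∧
        (SingleItem.Mechanism.mixture s q hq hq1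
          fun H => H.toMechanism).ExactlyImplements p π) ∧
    -- the polytope of feasible reduced forms respecting the orders, and its corners
    ((∀ i A, 0 < p i A) → ∀ ord : ∀ i, LinearOrder (T i),
      (∃ V : Finset (∀ i, T i → ℝ),
        SingleItem.feasibleRespecting p ord = convexHull ℝ (V : Set (∀ i, T i → ℝ))) ∧
      Module.finrank ℝ (vectorSpan ℝ (SingleItem.feasibleRespecting p ord)) =
        ∑ i, Fintype.card (T i) ∧
      (SingleItem.feasibleRespecting p ord).extremePoints ℝ =
        {π | ∃ H : SingleItem.HierarchicalMechanism T,
          H.IsStrict ∧ H.IsPartiallyOrderedWrt ord ∧ π = H.toMechanism.reducedForm p}) := by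
  refine ⟨fun π hπ => SingleItem.exists_mixture_of_mem_convexHull
    (hπ.mem_convexHull hp fun _ _ _ h => h), fun hpos ord => ⟨?_, ?_, ?_⟩⟩
  · refine ⟨(SingleItem.finite_hierarchicalForms p (SingleItem.rank ord)).toFinset, ?_⟩
    rw [Set.Finite.coe_toFinset]
    exact SingleItem.feasibleRespecting_eq_convexHull hp
  · rw [SingleItem.vectorSpan_feasibleRespecting hp, finrank_top, SingleItem.finrank_reducedForms]
  · rw [SingleItem.extremePoints_feasibleRespecting hp hpos]
    ext π
    simp only [SingleItem.hierarchicalForms, Set.mem_image, Set.mem_ofPred_eq,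
      SingleItem.HierarchicalMechanism.isPartiallyOrdered_rank_iff, and_assoc, eq_comm]
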